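/- Let $\ell \ge 1$ be an integer. For an integer $m \ge 1$ put $n = \ell m - 1$ and let $V_n(x) = \sum_{j=0}^{n} a_j \cos(jx)$, $x \in (0,2\pi)$, where $a_0, \dots, a_{\ell-1}$ are independent Gaussian random variables, each with distribution $\mathcal N(0,\sigma^2)$ for some $\sigma > 0$, and where $a_0, \dots, a_n$ are $\ell$-periodic, i.e. $a_{i+\ell} = a_i$ for all $0 \le i \le n-\ell$. Let $N_n(0,2\pi)$ be the number of distinct zeros of $V_n$ in $(0,2\pi)$. Then $$\mathbb E[N_n(0,2\pi)] = 2n + \mathcal O(n^{2/3}) \quad \text{as } n \to \infty,$$ where the implied constant depends only on $\ell$; that is, there is a constant $C$ depending only on $\ell$ such that, for all $m \ge 1$ and all $\sigma > 0$, the random variable $N_n(0,2\pi)$ has finite expectation and $|\mathbb E[N_n(0,2\pi)] - 2n| \le C\, n^{2/3}$. -/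

import Mathlib

open MeasureTheory ProbabilityTheory
open scoped NNReal ENNReal

/-- The cosine polynomial `V_n(x) = ∑_{j=0}^{n} c_j cos (j x)` with coefficients `c_0, …, c_n`. -/
noncomputable def cosPoly (n : ℕ) (c : ℕ → ℝ) (x : ℝ) : ℝ :=
  ∑ j ∈ Finset.range (n + 1), c j * Real.cos (j * x)

/-- The coefficients `c_0, …, c_n` are `ℓ`-periodic: `c_{i+ℓ} = c_i` for all `0 ≤ i ≤ n - ℓ`
(no condition if `n < ℓ`). Terms of the sequence beyond index `n` are irrelevant. -/
def IsPeriodicUpTo {α : Type*} (ℓ n : ℕ) (c : ℕ → α) : Prop :=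
  ∀ i : ℕ, i + ℓ ≤ n → c (i + ℓ) = c i

/-- The number of (distinct) real zeros of `f` in `S`, equal to `∞` if there are infinitely many. -/
noncomputable def zeroCount (f : ℝ → ℝ) (S : Set ℝ) : ℝ≥0∞ :=
  ((S ∩ {x | f x = 0}).encard : ℝ≥0∞)

/-! The error is in fact bounded: almost surely `2n - 2ℓ - 1 ≤ N_n ≤ 2n`. The upper bound is the
degree of `2 z^n V_n` as a polynomial in `z = e^{ix}` (`exists_finset_zeros_cosPoly`).

For the lower bound, write `n + 1 = ℓ(k+1)`. Periodicity gives `V_n(x) sin(ℓx/2) = sin((n+1)x/2)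
W(x)` with `W(x) = ∑_{j<ℓ} a_j cos(jx + kℓx/2)` (`cosPoly_mul_sin`). The sine on the right has `n`
zeros in `(0, 2π)`. All frequencies of `W` are at least `ℓk/2`, so `W` has at least `ℓk - 1` zeros
there by a Sturm–Hurwitz argument (`le_card_zeros_rePhase`).

Randomness enters only to make `a_0` nonzero and to keep `W` from vanishing at the zeros of that
sine, except possibly `π` (`ae_sum_mul_ne_zero`, `exists_cos_ne_zero`). Discarding the at most `ℓ`
zeros of `sin(ℓx/2)` leaves the claimed count. -/

/-! ### Sign changes and the Sturm–Hurwitz bound -/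

theorem exists_sign_of_ne_zero_on_Ioo {f : ℝ → ℝ} {a b : ℝ} (hf : ContinuousOn f (Set.Ioo a b))
    (h0 : ∀ x ∈ Set.Ioo a b, f x ≠ 0) :
    ∃ δ : ℝ, (δ = 1 ∨ δ = -1) ∧ ∀ x ∈ Set.Ioo a b, 0 < δ * f x := by
  by_cases h : ∃ x ∈ Set.Ioo a b, f x < 0
  · obtain ⟨x, hx, hfx⟩ := h
    refine ⟨-1, Or.inr rfl, fun y hy => ?_⟩
    by_contra hcon
    obtain ⟨w, hw, hw0⟩ := isPreconnected_Ioo.intermediate_value hx hy hf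
      (show (0 : ℝ) ∈ Set.Icc (f x) (f y) from ⟨hfx.le, by linarith⟩)
    exact h0 w hw hw0
  · push Not at h
    exact ⟨1, Or.inl rfl, fun x hx => by
      simpa using lt_of_le_of_ne (h x hx) (h0 x hx).symm⟩

/-- A continuous function with finitely many zeros has, up to a global sign, the sign of a
polynomial with simple roots at some of these zeros. -/
theorem exists_subset_sign_mul_prod_nonneg (Z : Finset ℝ) : ∀ (a b : ℝ) (f : ℝ → ℝ),
    ContinuousOn f (Set.Ioo a b) → (∀ x ∈ Set.Ioo a b, f x = 0 → x ∈ Z) →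
    ∃ S ⊆ Z, (∀ z ∈ S, z ∈ Set.Ioo a b) ∧ ∃ ε : ℝ, (ε = 1 ∨ ε = -1) ∧
      ∀ x ∈ Set.Ioo a b, 0 ≤ ε * f x * ∏ z ∈ S, (x - z) := by
  induction Z using Finset.induction_on_max with
  | empty =>
    intro a b f hf h
    obtain ⟨δ, hδ, hpos⟩ := exists_sign_of_ne_zero_on_Ioo hf
      (fun x hx h0 => by simpa using h x hx h0)
    exact ⟨∅, by simp, by simp, δ, hδ, fun x hx => by simpa using (hpos x hx).le⟩
  | insert z s hz ih =>
    intro a b f hf h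
    by_cases hzab : z ∈ Set.Ioo a b ∧ f z = 0
    · obtain ⟨hzab, hfz⟩ := hzab
      have hsub1 : Set.Ioo a z ⊆ Set.Ioo a b := Set.Ioo_subset_Ioo_right hzab.2.le
      have hsub2 : Set.Ioo z b ⊆ Set.Ioo a b := Set.Ioo_subset_Ioo_left hzab.1.le
      obtain ⟨S, hSs, hSab, ε, hε, hS⟩ := ih a z f (hf.mono hsub1) (fun x hx h0 => by
        rcases Finset.mem_insert.1 (h x (hsub1 hx) h0) with rfl | h'
        · exact absurd hx.2 (lt_irrefl _)
        · exact h')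
      obtain ⟨δ, hδ, hpos⟩ := exists_sign_of_ne_zero_on_Ioo (hf.mono hsub2) (fun x hx h0 => by
        rcases Finset.mem_insert.1 (h x (hsub2 hx) h0) with rfl | h'
        · exact absurd hx.1 (lt_irrefl _)
        · exact absurd (hz x h') (not_lt.2 hx.1.le))
      have hprod : ∀ x, z < x → 0 < ∏ w ∈ S, (x - w) := fun x hx =>
        Finset.prod_pos fun w hw => by linarith [hz w (hSs hw)]
      have hzS : z ∉ S := fun hmem => lt_irrefl _ (hz z (hSs hmem))
      -- Keep `z` as a root only if the sign changes there; the new factor is negative to the left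
      -- of `z`, hence the flip of `ε`.
      by_cases hδε : δ = ε
      · refine ⟨S, hSs.trans (Finset.subset_insert _ _), fun w hw => hsub1 (hSab w hw), ε, hε,
          fun x hx => ?_⟩
        rcases lt_trichotomy x z with hxz | rfl | hxz
        · exact hS x ⟨hx.1, hxz⟩
        · simp [hfz]
        · rw [← hδε]
          exact (mul_pos (hpos x ⟨hxz, hx.2⟩) (hprod x hxz)).le
      · have hδ' : δ = -ε := by
          rcases hδ with rfl | rfl <;> rcases hε with rfl | rfl <;> simp_all
        refine ⟨insert z S, Finset.insert_subset_insert _ hSs, fun w hw => ?_, -ε, ?_,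
          fun x hx => ?_⟩
        · rcases Finset.mem_insert.1 hw with rfl | hw
          · exact hzab
          · exact hsub1 (hSab w hw)
        · rcases hε with rfl | rfl <;> simp
        · rw [Finset.prod_insert hzS]
          rcases lt_trichotomy x z with hxz | rfl | hxz
          · have := mul_nonneg (hS x ⟨hx.1, hxz⟩) (sub_nonneg.2 hxz.le)
            linarith
          · simp [hfz]
          · rw [← hδ']
            exact (mul_pos (hpos x ⟨hxz, hx.2⟩) (mul_pos (sub_pos.2 hxz) (hprod x hxz))).le
    · obtain ⟨S, hSs, hSab, hS⟩ := ih a b f hf (fun x hx h0 => by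
        rcases Finset.mem_insert.1 (h x hx h0) with rfl | h'
        · exact absurd ⟨hx, h0⟩ hzab
        · exact h')
      exact ⟨S, hSs.trans (Finset.subset_insert _ _), hSab, hS⟩

/-- Mean value property on the unit circle. -/
theorem integral_re_eval_exp_eq_zero (R : Polynomial ℂ) (hR : R.eval 0 = 0) :
    ∫ x in (0 : ℝ)..2 * Real.pi, (R.eval (Complex.exp (x * Complex.I))).re = 0 := by
  have h1 : Real.circleAverage (fun z => R.eval z) 0 1 = R.eval 0 :=
    circleAverage_of_differentiable_on_off_countable Set.countable_empty
      R.continuous.continuousOn (fun z _ => R.differentiable z)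
  rw [hR, Real.circleAverage_def] at h1
  have h2 : ∫ x in (0 : ℝ)..2 * Real.pi, R.eval (Complex.exp (x * Complex.I)) = 0 := by
    simpa [circleMap, Real.pi_ne_zero] using h1
  have h3 := Complex.reCLM.intervalIntegral_comp_comm (μ := volume) (a := 0) (b := 2 * Real.pi)
    (f := fun x : ℝ => R.eval (Complex.exp (x * Complex.I)))
    (Continuous.intervalIntegrable (R.continuous.comp (by fun_prop)) _ _)
  rw [h2] at h3
  simpa using h3

/-- Each factor times `e^{ix/2}` is affine in `e^{ix}`. -/
theorem exists_polynomial_prod_sin (S : Finset ℝ) : ∃ Q : Polynomial ℂ, ∀ x : ℝ,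
    ((∏ z ∈ S, Real.sin ((x - z) / 2) : ℝ) : ℂ) * Complex.exp (S.card * (x / 2 * Complex.I)) =
      Q.eval (Complex.exp (x * Complex.I)) := by
  induction S using Finset.induction_on with
  | empty => exact ⟨1, fun x => by simp⟩
  | insert z S hz ih =>
    obtain ⟨Q, hQ⟩ := ih
    refine ⟨(Polynomial.C (Complex.exp (-(z / 2) * Complex.I)) * Polynomial.X -
      Polynomial.C (Complex.exp (z / 2 * Complex.I))) * Polynomial.C (-Complex.I / 2) * Q,
      fun x => ?_⟩
    rw [Polynomial.eval_mul, ← hQ x, Finset.prod_insert hz, Finset.card_insert_of_notMem hz]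
    have hsplit : Complex.exp (((S.card + 1 : ℕ) : ℂ) * (x / 2 * Complex.I)) =
        Complex.exp (S.card * (x / 2 * Complex.I)) * Complex.exp (x / 2 * Complex.I) := by
      rw [← Complex.exp_add]; push_cast; ring_nf
    have hsin : (Real.sin ((x - z) / 2) : ℂ) * Complex.exp (x / 2 * Complex.I) =
        (Complex.exp (-(z / 2) * Complex.I) * Complex.exp (x * Complex.I) -
          Complex.exp (z / 2 * Complex.I)) * (-Complex.I / 2) := by
      rw [Complex.ofReal_sin, Complex.sin]
      push_cast
      have e1 : Complex.exp (-(((x : ℂ) - z) / 2) * Complex.I) * Complex.exp (x / 2 * Complex.I) =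
          Complex.exp (z / 2 * Complex.I) := by
        rw [← Complex.exp_add]; ring_nf
      have e2 : Complex.exp ((((x : ℂ) - z) / 2) * Complex.I) * Complex.exp (x / 2 * Complex.I) =
          Complex.exp (-(z / 2) * Complex.I) * Complex.exp (x * Complex.I) := by
        rw [← Complex.exp_add, ← Complex.exp_add]; ring_nf
      rw [← e1, ← e2]; ring
    rw [hsplit]
    push_cast at hsin ⊢
    simp only [Polynomial.eval_mul, Polynomial.eval_sub, Polynomial.eval_C, Polynomial.eval_X]
    rw [← hsin]; ring

theorem sub_mul_sin_half_sub_nonneg {x z : ℝ} (hx : x ∈ Set.Ioo 0 (2 * Real.pi))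
    (hz : z ∈ Set.Ioo 0 (2 * Real.pi)) : 0 ≤ (x - z) * Real.sin ((x - z) / 2) := by
  rcases le_total z x with h | h
  · exact mul_nonneg (by linarith) (Real.sin_nonneg_of_nonneg_of_le_pi (by linarith)
      (by linarith [hx.2, hz.1]))
  · exact mul_nonneg_of_nonpos_of_nonpos (by linarith)
      (Real.sin_nonpos_of_nonpos_of_neg_pi_le (by linarith) (by linarith [hx.1, hz.2]))

/-- The real part of `e^{iMx/2} P(e^{ix})`. -/
noncomputable def rePhase (M : ℕ) (P : Polynomial ℂ) (x : ℝ) : ℝ :=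
  (Complex.exp (M * (x / 2 * Complex.I)) * P.eval (Complex.exp (x * Complex.I))).re

theorem continuous_rePhase (M : ℕ) (P : Polynomial ℂ) : Continuous (rePhase M P) := by
  unfold rePhase
  exact Complex.continuous_re.comp
    ((by fun_prop : Continuous fun x : ℝ => Complex.exp (M * (x / 2 * Complex.I))).mul
      (P.continuous.comp (by fun_prop)))

/-- Orthogonality of high and low frequencies: the phase splits as `e^{idx} e^{i|S|x/2}`, so the
integrand is the real part of a polynomial in `e^{ix}` divisible by `X ^ d`. -/
theorem integral_rePhase_mul_prod_sin (M : ℕ) (P : Polynomial ℂ) (S : Finset ℝ) (d : ℕ)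
    (hd : 1 ≤ d) (hM : M = S.card + 2 * d) :
    ∫ x in (0 : ℝ)..2 * Real.pi, rePhase M P x * ∏ z ∈ S, Real.sin ((x - z) / 2) = 0 := by
  obtain ⟨Q, hQ⟩ := exists_polynomial_prod_sin S
  have hR : Polynomial.eval 0 (Polynomial.X ^ d * Q * P) = (0 : ℂ) := by
    simp [Nat.one_le_iff_ne_zero.1 hd]
  refine Eq.trans ?_ (integral_re_eval_exp_eq_zero _ hR)
  apply intervalIntegral.integral_congr
  intro x _
  simp only [Polynomial.eval_mul, Polynomial.eval_pow, Polynomial.eval_X]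
  rw [← hQ x, rePhase, mul_comm, ← Complex.re_ofReal_mul]
  congr 1
  have : Complex.exp (M * (x / 2 * Complex.I)) =
      Complex.exp (x * Complex.I) ^ d * Complex.exp (S.card * (x / 2 * Complex.I)) := by
    rw [← Complex.exp_nat_mul, ← Complex.exp_add, hM]; push_cast; ring_nf
  rw [this]; ring

/-- Sturm–Hurwitz: a trigonometric sum with frequencies `≥ M / 2` has at least `M - 1` zeros
in a period. -/
theorem le_card_zeros_rePhase (M : ℕ) (P : Polynomial ℂ) (Z : Finset ℝ)
    (hZ : ∀ x ∈ Set.Ioo 0 (2 * Real.pi), rePhase M P x = 0 → x ∈ Z) : M ≤ Z.card + 1 := by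
  by_contra! hlt
  obtain ⟨S, hSZ, hSI, ε, hε, hS⟩ := exists_subset_sign_mul_prod_nonneg Z 0 (2 * Real.pi)
    (rePhase M P) (continuous_rePhase M P).continuousOn hZ
  have hcard := Finset.card_le_card hSZ
  -- add a root at `0` to adjust the parity
  obtain ⟨T, hT, d, hd, hMd⟩ : ∃ T : Finset ℝ, (T = S ∨ T = insert 0 S) ∧
      ∃ d, 1 ≤ d ∧ M = T.card + 2 * d := by
    have h0S : (0 : ℝ) ∉ S := fun h => lt_irrefl _ (hSI 0 h).1
    rcases Nat.even_or_odd' (M - S.card) with ⟨d, hd | hd⟩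
    · exact ⟨S, Or.inl rfl, d, by omega, by omega⟩
    · exact ⟨insert 0 S, Or.inr rfl, d, by omega, by
        rw [Finset.card_insert_of_notMem h0S]; omega⟩
  have hint := integral_rePhase_mul_prod_sin M P T d hd hMd
  set h : ℝ → ℝ := fun x => ε * (rePhase M P x * ∏ z ∈ T, Real.sin ((x - z) / 2)) with hh
  have hcont : Continuous h := continuous_const.mul ((continuous_rePhase M P).mul (by fun_prop))
  -- The extra root at `0` contributes `sin(x/2)`, positive on the open period, so signs are
  -- unaffected.
  have hTS : ∀ x ∈ Set.Ioo 0 (2 * Real.pi), ∃ k : ℝ, 0 < k ∧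
      ∏ z ∈ T, Real.sin ((x - z) / 2) = k * ∏ z ∈ S, Real.sin ((x - z) / 2) := by
    intro x hx
    rcases hT with rfl | rfl
    · exact ⟨1, one_pos, by simp⟩
    · refine ⟨Real.sin (x / 2), Real.sin_pos_of_pos_of_lt_pi (by linarith [hx.1])
        (by linarith [hx.2]), ?_⟩
      rw [Finset.prod_insert fun h => lt_irrefl _ (hSI 0 h).1, sub_zero]
  have hnn : ∀ x ∈ Set.Ioo 0 (2 * Real.pi), 0 ≤ h x := by
    intro x hx
    obtain ⟨k, hk, hkT⟩ := hTS x hx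
    have hAB : 0 ≤ (∏ z ∈ S, (x - z)) * ∏ z ∈ S, Real.sin ((x - z) / 2) := by
      rw [← Finset.prod_mul_distrib]
      exact Finset.prod_nonneg fun z hz => sub_mul_sin_half_sub_nonneg hx (hSI z hz)
    simp only [hh, hkT]
    by_cases hxS : x ∈ S
    · rw [Finset.prod_eq_zero hxS (by simp)]; simp
    · have hA : ∏ z ∈ S, (x - z) ≠ 0 := Finset.prod_ne_zero_iff.2 fun z hz =>
        sub_ne_zero.2 fun h => hxS (h ▸ hz)
      -- Passes from linear factors to half-angle sines, which have the same signs here, then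
      -- divides out a square.
      have := mul_nonneg (hS x hx) hAB
      have h2 : 0 ≤ (ε * rePhase M P x * ∏ z ∈ S, Real.sin ((x - z) / 2)) *
          (∏ z ∈ S, (x - z)) ^ 2 := by linarith
      have h3 := nonneg_of_mul_nonneg_left h2 (by positivity)
      have := mul_nonneg hk.le h3
      linarith
  have hnn' : ∀ x ∈ Set.Icc 0 (2 * Real.pi), 0 ≤ h x := by
    rw [← closure_Ioo (by positivity)]
    exact closure_minimal (s := Set.Ioo 0 (2 * Real.pi)) (t := {x | 0 ≤ h x}) hnn
      (isClosed_le continuous_const hcont)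
  obtain ⟨c, hcI, hcZ⟩ := (Set.Ioo_infinite (show (0 : ℝ) < 2 * Real.pi by
    positivity)).exists_notMem_finset Z
  have hc : h c ≠ 0 := by
    obtain ⟨k, hk, hkT⟩ := hTS c hcI
    have h1 : ∏ z ∈ S, Real.sin ((c - z) / 2) ≠ 0 := Finset.prod_ne_zero_iff.2 fun z hz h0 => by
      rw [Real.sin_eq_zero_iff_of_lt_of_lt (by linarith [hcI.1, (hSI z hz).2])
        (by linarith [hcI.2, (hSI z hz).1])] at h0
      exact hcZ ((by linarith : c = z) ▸ hSZ hz)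
    simp only [hh, hkT]
    have h2 : rePhase M P c ≠ 0 := fun h0 => hcZ (hZ c hcI h0)
    have h3 : ε ≠ 0 := by rcases hε with rfl | rfl <;> norm_num
    exact mul_ne_zero h3 (mul_ne_zero h2 (mul_ne_zero hk.ne' h1))
  have hpos : 0 < ∫ x in (0 : ℝ)..2 * Real.pi, h x :=
    intervalIntegral.integral_pos (by positivity) hcont.continuousOn
      (fun x hx => hnn' x ⟨hx.1.le, hx.2⟩)
      ⟨c, ⟨hcI.1.le, hcI.2.le⟩, lt_of_le_of_ne (hnn c hcI) hc.symm⟩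
  rw [hh, intervalIntegral.integral_const_mul, hint, mul_zero] at hpos
  exact lt_irrefl _ hpos

/-! ### Upper bound by the degree -/

theorem injOn_exp_mul_I_Ioo :
    Set.InjOn (fun x : ℝ => Complex.exp (x * Complex.I)) (Set.Ioo 0 (2 * Real.pi)) := by
  intro x hx y hy hxy
  obtain ⟨k, hk⟩ := Complex.exp_eq_exp_iff_exists_int.1 hxy
  have h1 : x = y + k * (2 * Real.pi) := by
    have : (x : ℂ) * Complex.I = (y + k * (2 * Real.pi)) * Complex.I := by rw [hk]; ring
    exact_mod_cast mul_right_cancel₀ Complex.I_ne_zero this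
  have hpi := Real.pi_pos
  have hk1 : (k : ℝ) < 1 := by
    by_contra! h
    nlinarith [hx.2, hy.1]
  have hk2 : (-1 : ℝ) < k := by
    by_contra! h
    nlinarith [hx.1, hy.2]
  have hk0 : k = 0 := by
    have h3 : k < 1 := by exact_mod_cast hk1
    have h4 : -1 < k := by exact_mod_cast hk2
    omega
  simpa [hk0] using h1

/-- `2 z^n V_n` as a polynomial in `z = e^{ix}`. -/
noncomputable def cosPolyPolynomial (n : ℕ) (c : ℕ → ℝ) : Polynomial ℂ :=
  ∑ j ∈ Finset.range (n + 1),
    Polynomial.C (c j : ℂ) * (Polynomial.X ^ (n + j) + Polynomial.X ^ (n - j))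

theorem eval_cosPolyPolynomial (n : ℕ) (c : ℕ → ℝ) (x : ℝ) :
    (cosPolyPolynomial n c).eval (Complex.exp (x * Complex.I)) =
      2 * Complex.exp (x * Complex.I) ^ n * (cosPoly n c x : ℂ) := by
  simp only [cosPolyPolynomial, cosPoly, Polynomial.eval_finsetSum, Polynomial.eval_mul,
    Polynomial.eval_C, Polynomial.eval_add, Polynomial.eval_pow, Polynomial.eval_X,
    Complex.ofReal_sum, Finset.mul_sum]
  refine Finset.sum_congr rfl fun j hj => ?_
  have hj' : j ≤ n := Nat.lt_succ_iff.1 (Finset.mem_range.1 hj)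
  have hE := Complex.exp_ne_zero (x * Complex.I)
  push_cast
  rw [Complex.cos, pow_add, pow_sub₀ _ hE hj', ← Complex.exp_nat_mul _ j, ← Complex.exp_neg]
  ring_nf

/-- The two monomials of index `j` meet degree `n` only for `j = 0`, where they coincide. This makes
the polynomial nonzero once `c 0 ≠ 0`. -/
theorem coeff_cosPolyPolynomial_self (n : ℕ) (c : ℕ → ℝ) :
    (cosPolyPolynomial n c).coeff n = 2 * c 0 := by
  rw [cosPolyPolynomial, Polynomial.finsetSum_coeff, Finset.sum_eq_single 0]
  · simp [Polynomial.coeff_X_pow]; ring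
  · intro j hj hj0
    have hj' : j ≤ n := Nat.lt_succ_iff.1 (Finset.mem_range.1 hj)
    have h2 : n ≠ n - j := by omega
    simp [Polynomial.coeff_X_pow, hj0, h2]
  · simp

theorem natDegree_cosPolyPolynomial_le (n : ℕ) (c : ℕ → ℝ) :
    (cosPolyPolynomial n c).natDegree ≤ 2 * n := by
  refine Polynomial.natDegree_sum_le_of_forall_le _ _ fun j hj => ?_
  have hj' : j ≤ n := Nat.lt_succ_iff.1 (Finset.mem_range.1 hj)
  refine (Polynomial.natDegree_C_mul_le _ _).trans ((Polynomial.natDegree_add_le _ _).trans ?_)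
  simp only [Polynomial.natDegree_X_pow]
  omega

/-- A cosine polynomial of degree `n` with nonzero constant term has at most `2n` zeros in
`(0, 2π)`. -/
theorem exists_finset_zeros_cosPoly (n : ℕ) (c : ℕ → ℝ) (hc : c 0 ≠ 0) :
    ∃ Z : Finset ℝ, (Z : Set ℝ) = Set.Ioo 0 (2 * Real.pi) ∩ {x | cosPoly n c x = 0} ∧
      Z.card ≤ 2 * n := by
  set p := cosPolyPolynomial n c
  have hp : p ≠ 0 := fun h => by
    have := coeff_cosPolyPolynomial_self n c
    simp only [show cosPolyPolynomial n c = 0 from h, Polynomial.coeff_zero] at this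
    exact hc (by simpa using this.symm)
  have hinj := injOn_exp_mul_I_Ioo.mono
    (Set.inter_subset_left (s := Set.Ioo 0 (2 * Real.pi)) (t := {x | cosPoly n c x = 0}))
  have hmaps : Set.MapsTo (fun x : ℝ => Complex.exp (x * Complex.I))
      (Set.Ioo 0 (2 * Real.pi) ∩ {x | cosPoly n c x = 0}) (p.roots.toFinset : Set ℂ) := by
    rintro x ⟨-, hx⟩
    have hx' : cosPoly n c x = 0 := hx
    simp [p, hp, eval_cosPolyPolynomial, hx']
  have hfin : (Set.Ioo 0 (2 * Real.pi) ∩ {x | cosPoly n c x = 0}).Finite :=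
    Set.Finite.of_injOn hmaps hinj (Finset.finite_toSet _)
  refine ⟨hfin.toFinset, by simp, ?_⟩
  calc hfin.toFinset.card ≤ p.roots.toFinset.card :=
        Finset.card_le_card_of_injOn _ (by simpa using hmaps) (by simpa using hinj)
    _ ≤ Multiset.card p.roots := Multiset.toFinset_card_le _
    _ ≤ p.natDegree := Polynomial.card_roots' p
    _ ≤ 2 * n := natDegree_cosPolyPolynomial_le n c

/-! ### Factorization of periodic cosine polynomials -/

/-- The polynomial `∑_{j<ℓ} c_j X^j` of one period of the coefficients. -/
noncomputable def periodPolynomial (ℓ : ℕ) (c : ℕ → ℝ) : Polynomial ℂ :=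
  ∑ j ∈ Finset.range ℓ, Polynomial.C (c j : ℂ) * Polynomial.X ^ j

theorem rePhase_periodPolynomial (M ℓ : ℕ) (c : ℕ → ℝ) (x : ℝ) :
    rePhase M (periodPolynomial ℓ c) x =
      ∑ j ∈ Finset.range ℓ, c j * Real.cos (j * x + M * (x / 2)) := by
  simp only [rePhase, periodPolynomial, Polynomial.eval_finsetSum, Finset.mul_sum, Complex.re_sum]
  refine Finset.sum_congr rfl fun j _ => ?_
  simp only [Polynomial.eval_mul, Polynomial.eval_C, Polynomial.eval_pow, Polynomial.eval_X]
  rw [mul_left_comm, Complex.re_ofReal_mul, ← Complex.exp_nat_mul, ← Complex.exp_add,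
    ← Complex.exp_ofReal_mul_I_re]
  congr 3
  push_cast; ring

theorem IsPeriodicUpTo.apply_mul_add {α : Type*} {ℓ n : ℕ} {c : ℕ → α}
    (hc : IsPeriodicUpTo ℓ n c) (k j : ℕ) (h : ℓ * k + j ≤ n) : c (ℓ * k + j) = c j := by
  induction k with
  | zero => simp
  | succ k ih =>
    rw [Nat.mul_succ] at h
    rw [← ih (by omega), ← hc (ℓ * k + j) (by omega)]
    congr 1; ring

/-- For each residue `j`, this is the closed form of a sum of cosines in arithmetic progression,
proved by adding one period at a time. -/
theorem sum_range_mul_sin (ℓ n : ℕ) (c : ℕ → ℝ) (hc : IsPeriodicUpTo ℓ n c) (x : ℝ) (k : ℕ)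
    (hk : ℓ * (k + 1) ≤ n + 1) :
    (∑ j ∈ Finset.range (ℓ * (k + 1)), c j * Real.cos (j * x)) * Real.sin (ℓ * (x / 2)) =
      Real.sin ((k + 1) * (ℓ * (x / 2))) *
        ∑ j ∈ Finset.range ℓ, c j * Real.cos (j * x + k * (ℓ * (x / 2))) := by
  induction k with
  | zero => simp [mul_comm]
  | succ k ih =>
    rw [Nat.mul_succ] at hk
    rw [Nat.mul_succ, Finset.sum_range_add, add_mul, ih (by omega), Finset.mul_sum,
      Finset.mul_sum, Finset.sum_mul, ← Finset.sum_add_distrib]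
    refine Finset.sum_congr rfl fun j hj => ?_
    rw [hc.apply_mul_add _ _ (by have := Finset.mem_range.1 hj; omega)]
    -- With `v = (K+1)B` and `u = θ + v`, this reads `sin v cos(u-B) + cos(u+v) sin B = sin(v+B) cos
    -- u`.
    have key : ∀ θ B K : ℝ, Real.sin ((K + 1) * B) * Real.cos (θ + K * B) +
        Real.cos (2 * ((K + 1) * B) + θ) * Real.sin B =
        Real.sin ((K + 1 + 1) * B) * Real.cos (θ + (K + 1) * B) := by
      intro θ B K
      have e1 : θ + K * B = (θ + (K + 1) * B) - B := by ring
      have e2 : 2 * ((K + 1) * B) + θ = (θ + (K + 1) * B) + (K + 1) * B := by ring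
      have e3 : (K + 1 + 1) * B = (K + 1) * B + B := by ring
      rw [e1, e2, e3]
      generalize θ + (K + 1) * B = u
      generalize (K + 1) * B = v
      rw [Real.cos_sub, Real.cos_add, Real.sin_add]
      ring
    have := key (j * x) (ℓ * (x / 2)) k
    have e : ((ℓ * (k + 1) + j : ℕ) : ℝ) * x = 2 * (((k : ℝ) + 1) * (ℓ * (x / 2))) + j * x := by
      push_cast; ring
    rw [e]
    push_cast
    linear_combination c j * this

theorem cosPoly_mul_sin (ℓ k n : ℕ) (hn : n + 1 = ℓ * (k + 1)) (c : ℕ → ℝ)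
    (hc : IsPeriodicUpTo ℓ n c) (x : ℝ) :
    cosPoly n c x * Real.sin (ℓ * (x / 2)) =
      Real.sin ((n + 1) * (x / 2)) * rePhase (ℓ * k) (periodPolynomial ℓ c) x := by
  have h := sum_range_mul_sin ℓ n c hc x k hn.ge
  have e : ((n : ℝ) + 1) = ℓ * (k + 1) := by exact_mod_cast hn
  rw [cosPoly, hn, h, e, rePhase_periodPolynomial]
  push_cast
  congr 1
  · ring_nf
  · refine Finset.sum_congr rfl fun j _ => ?_
    ring_nf

/-! ### Zeros of the sine factors and the deterministic lower bound -/

/-- The points `2πr/q`, `r ∈ s`. -/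
noncomputable def circlePoints (q : ℕ) (s : Finset ℕ) : Finset ℝ :=
  s.image fun r : ℕ => 2 * Real.pi * r / q

theorem mem_circlePoints_of_sin_eq_zero {q : ℕ} {x : ℝ}
    (hx : x ∈ Set.Ioo 0 (2 * Real.pi)) (h : Real.sin (q * (x / 2)) = 0) (hq : 1 ≤ q) :
    x ∈ circlePoints q (Finset.range q) := by
  obtain ⟨r, hr⟩ := Real.sin_eq_zero_iff.1 h
  have hpi := Real.pi_pos
  have hq0 : (0 : ℝ) < q := by exact_mod_cast hq
  have hr0 : (0 : ℝ) < r := by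
    by_contra! hcon
    nlinarith [mul_pos hq0 hx.1]
  have hrq : (r : ℝ) < q := by
    by_contra! hcon
    nlinarith [mul_lt_mul_of_pos_left hx.2 hq0]
  lift r to ℕ using (by exact_mod_cast hr0.le)
  refine Finset.mem_image.2 ⟨r, Finset.mem_range.2 (by exact_mod_cast hrq), ?_⟩
  push_cast at hr
  field_simp
  linarith

theorem sin_eq_zero_of_mem_circlePoints {q : ℕ} (hq : 1 ≤ q) {s : Finset ℕ} {x : ℝ}
    (h : x ∈ circlePoints q s) : Real.sin (q * (x / 2)) = 0 := by
  obtain ⟨r, -, rfl⟩ := Finset.mem_image.1 h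
  have hq0 : (q : ℝ) ≠ 0 := by positivity
  rw [show (q : ℝ) * (2 * Real.pi * r / q / 2) = r * Real.pi by field_simp]
  exact Real.sin_nat_mul_pi r

theorem card_circlePoints {q : ℕ} (hq : 1 ≤ q) (s : Finset ℕ) :
    (circlePoints q s).card = s.card := by
  have hq0 : (q : ℝ) ≠ 0 := by positivity
  refine Finset.card_image_of_injective _ fun a b h => ?_
  have hpi := Real.pi_pos.ne'
  have h' : 2 * Real.pi * a / q = 2 * Real.pi * b / q := h
  field_simp at h'
  exact_mod_cast h'

theorem circlePoints_subset_Ioo (n : ℕ) {x : ℝ}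
    (h : x ∈ circlePoints (n + 1) (Finset.Icc 1 n)) : x ∈ Set.Ioo 0 (2 * Real.pi) := by
  obtain ⟨r, hr, rfl⟩ := Finset.mem_image.1 h
  rw [Finset.mem_Icc] at hr
  have hpi := Real.pi_pos
  have h1 : (1 : ℝ) ≤ r := by exact_mod_cast hr.1
  have h2 : (r : ℝ) < (n + 1 : ℕ) := by exact_mod_cast Nat.lt_succ_of_le hr.2
  have h3 : (0 : ℝ) < (n + 1 : ℕ) := by positivity
  refine ⟨by positivity, ?_⟩
  rw [div_lt_iff₀ h3]
  exact mul_lt_mul_of_pos_left h2 (by positivity)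

theorem eq_pi_of_cos_half_eq_zero {x : ℝ} (hx : x ∈ Set.Ioo 0 (2 * Real.pi))
    (h : Real.cos (x / 2) = 0) : x = Real.pi := by
  have := Real.injOn_cos (⟨by linarith [hx.1], by linarith [hx.2]⟩ : x / 2 ∈ Set.Icc 0 Real.pi)
    (⟨by linarith [Real.pi_pos], by linarith [Real.pi_pos]⟩ : Real.pi / 2 ∈ Set.Icc 0 Real.pi)
    (by rw [h, Real.cos_pi_div_two])
  linarith

/-- If the terms `j = 0` and `j = 1` both vanish, then `sin x = 0`, forcing `x = π`. For `ℓ = 1`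
only `j = 0` is available, and the sine hypothesis replaces the second equation. -/
theorem exists_cos_ne_zero {ℓ M : ℕ} (hℓ : 1 ≤ ℓ) {x : ℝ} (hx : x ∈ Set.Ioo 0 (2 * Real.pi))
    (hxpi : x ≠ Real.pi) (hsin : Real.sin ((M + ℓ : ℕ) * (x / 2)) = 0) :
    ∃ j < ℓ, Real.cos (j * x + M * (x / 2)) ≠ 0 := by
  by_contra! hcon
  have hA : Real.cos (M * (x / 2)) = 0 := by simpa using hcon 0 hℓ
  have hsA : Real.sin (M * (x / 2)) ≠ 0 := fun h => by
    simpa [h, hA] using Real.sin_sq_add_cos_sq (M * (x / 2))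
  rcases hℓ.eq_or_lt with rfl | hlt
  · push_cast at hsin
    rw [add_mul, one_mul, Real.sin_add, hA, zero_mul, add_zero] at hsin
    exact hxpi (eq_pi_of_cos_half_eq_zero hx ((mul_eq_zero.1 hsin).resolve_left hsA))
  · have h1 := hcon 1 hlt
    rw [Nat.cast_one, one_mul, Real.cos_add, hA, mul_zero, zero_sub, neg_eq_zero] at h1
    have h2 := (mul_eq_zero.1 h1).resolve_right hsA
    rw [show x = 2 * (x / 2) by ring, Real.sin_two_mul] at h2
    have h3 : 0 < Real.sin (x / 2) :=
      Real.sin_pos_of_pos_of_lt_pi (by linarith [hx.1]) (by linarith [hx.2])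
    exact hxpi (eq_pi_of_cos_half_eq_zero hx
      ((mul_eq_zero.1 h2).resolve_left (mul_pos two_pos h3).ne'))

/-- Generically, a cosine polynomial with `ℓ`-periodic coefficients has at least `2n - 2ℓ - 1`
zeros in `(0, 2π)`. -/
theorem two_mul_le_card_zeros_cosPoly (ℓ k n : ℕ) (hℓ : 1 ≤ ℓ) (hn : n + 1 = ℓ * (k + 1))
    (c : ℕ → ℝ) (hc : IsPeriodicUpTo ℓ n c) (Z : Finset ℝ)
    (hZ : (Z : Set ℝ) = Set.Ioo 0 (2 * Real.pi) ∩ {x | cosPoly n c x = 0})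
    (hgen : ∀ x ∈ circlePoints (n + 1) (Finset.Icc 1 n), x ≠ Real.pi →
      rePhase (ℓ * k) (periodPolynomial ℓ c) x ≠ 0) :
    2 * n ≤ Z.card + (2 * ℓ + 1) := by
  classical
  set W := rePhase (ℓ * k) (periodPolynomial ℓ c) with hW
  -- `E` also contains `0`, outside the open interval; this only enlarges the constant.
  set E := circlePoints ℓ (Finset.range ℓ)
  set D := circlePoints (n + 1) (Finset.Icc 1 n)
  have hmemZ : ∀ x, x ∈ Z ↔ x ∈ Set.Ioo 0 (2 * Real.pi) ∧ cosPoly n c x = 0 := fun x => by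
    rw [← Finset.mem_coe, hZ]; rfl
  have hZE : ∀ x ∈ Set.Ioo 0 (2 * Real.pi), cosPoly n c x * Real.sin (ℓ * (x / 2)) = 0 →
      x ∈ Z ∪ E := by
    intro x hx h
    rcases mul_eq_zero.1 h with h | h
    · exact Finset.mem_union_left _ ((hmemZ x).2 ⟨hx, h⟩)
    · exact Finset.mem_union_right _ (mem_circlePoints_of_sin_eq_zero hx h hℓ)
  set ZW := (Z ∪ E).filter fun x => W x = 0
  have hZWcard : ℓ * k ≤ ZW.card + 1 := le_card_zeros_rePhase _ _ ZW fun x hx h0 =>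
    Finset.mem_filter.2 ⟨hZE x hx (by
      rw [cosPoly_mul_sin ℓ k n hn c hc, h0, mul_zero]), h0⟩
  have hDsub : D ⊆ Z ∪ E := fun x hx => hZE x (circlePoints_subset_Ioo n hx) (by
    have := sin_eq_zero_of_mem_circlePoints (Nat.le_add_left 1 n) hx
    push_cast at this
    rw [cosPoly_mul_sin ℓ k n hn c hc, this, zero_mul])
  have hinter : ZW ∩ D ⊆ {Real.pi} := fun x hx => by
    rw [Finset.mem_inter] at hx
    rw [Finset.mem_singleton]
    by_contra hne
    exact hgen x hx.2 hne (Finset.mem_filter.1 hx.1).2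
  -- The count: `|Z| + ℓ ≥ (ℓk - 1) + n - 1` with `ℓk = n + 1 - ℓ`; the last `1` pays for `π`.
  have h1 := Finset.card_union_add_card_inter ZW D
  have h2 := Finset.card_le_card (Finset.union_subset (Finset.filter_subset _ _) hDsub :
    ZW ∪ D ⊆ Z ∪ E)
  have h3 := Finset.card_union_le Z E
  have h4 := Finset.card_le_card hinter
  have h5 : E.card = ℓ := by simp [E, card_circlePoints hℓ]
  have h6 : D.card = n := by simp [D, card_circlePoints (Nat.le_add_left 1 n)]
  rw [Finset.card_singleton] at h4
  rw [Nat.mul_succ] at hn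
  omega

/-! ### Gaussian linear combinations -/

/-- A nontrivial linear combination of independent nondegenerate Gaussians almost surely does
not vanish. -/
theorem ae_sum_mul_ne_zero {Ω ι : Type*} [MeasurableSpace Ω] [Fintype ι] {P : Measure Ω}
    [IsProbabilityMeasure P] {X : ι → Ω → ℝ} {v : ℝ≥0} (hv : 0 < v) (hind : iIndepFun X P)
    (hlaw : ∀ i, HasLaw (X i) (gaussianReal 0 v) P) (b : ι → ℝ) (hb : ∃ i, b i ≠ 0) :
    ∀ᵐ ω ∂P, ∑ i, b i * X i ω ≠ 0 := by
  set Y : ι → Ω → ℝ := fun i ω => b i * X i ω with hY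
  have hYg : ∀ i, HasGaussianLaw (Y i) P := fun i => (hlaw i).hasGaussianLaw.fun_smul (b i)
  have hYind : iIndepFun Y P :=
    hind.comp (fun i x => b i * x) (fun i => measurable_const_mul (b i))
  have hS : HasGaussianLaw (fun ω => ∑ i, Y i ω) P := hYind.hasGaussianLaw_fun_sum hYg
  have hvar : 0 < Var[fun ω => ∑ i, Y i ω; P] := by
    have hsum : Var[∑ i, Y i; P] = ∑ i, Var[Y i; P] :=
      IndepFun.variance_sum (fun i _ => (hYg i).memLp_two)
        (fun i _ j _ hij => hYind.indepFun hij)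
    have hfun : (fun ω => ∑ i, Y i ω) = ∑ i, Y i := by ext ω; simp
    have hYvar : ∀ i, Var[Y i; P] = b i ^ 2 * v := fun i => by
      rw [hY, variance_const_mul, (hlaw i).variance_eq, variance_id_gaussianReal]
    rw [hfun, hsum]
    obtain ⟨i, hi⟩ := hb
    refine Finset.sum_pos' (fun j _ => variance_nonneg _ _) ⟨i, Finset.mem_univ i, ?_⟩
    rw [hYvar]
    positivity
  have hmap := hS.map_eq_gaussianReal
  have hno : NullSingletonClass (P.map fun ω => ∑ i, Y i ω) := by
    rw [hmap]
    exact nullSingletonClass_gaussianReal (by simpa using hvar)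
  have h0 : (P.map fun ω => ∑ i, Y i ω) {0} = 0 := measure_singleton 0
  rw [Measure.map_apply_of_aemeasurable hS.aemeasurable (measurableSet_singleton 0)] at h0
  exact measure_eq_zero_iff_ae_notMem.1 h0

/-! ### Measurability of the zero count -/

/-- By compactness `|f|` attains its minimum, so a zero exists as soon as `|f|` is arbitrarily small
at rational points; this is a countable condition. -/
theorem exists_zero_Icc_iff {f : ℝ → ℝ} (hf : Continuous f) {p q : ℝ} (hpq : p < q) :
    (∃ x ∈ Set.Icc p q, f x = 0) ↔
      ∀ k : ℕ, ∃ r : ℚ, (r : ℝ) ∈ Set.Icc p q ∧ |f r| < 1 / ((k : ℝ) + 1) := by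
  constructor
  · rintro ⟨x, hx, hfx⟩ k
    have hopen : IsOpen {y | |f y| < 1 / ((k : ℝ) + 1)} := isOpen_lt hf.abs continuous_const
    rw [← closure_Ioo hpq.ne] at hx
    obtain ⟨y, hy1, hy2⟩ := mem_closure_iff.1 hx _ hopen
      (by simp only [Set.mem_ofPred_eq, hfx, abs_zero]; positivity)
    obtain ⟨r, hr⟩ := (Rat.denseRange_cast (𝕜 := ℝ)).exists_mem_open (hopen.inter isOpen_Ioo)
      ⟨y, hy1, hy2⟩
    exact ⟨r, Set.Ioo_subset_Icc_self hr.2, hr.1⟩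
  · intro h
    obtain ⟨x, hx, hmin⟩ := isCompact_Icc.exists_isMinOn (Set.nonempty_Icc.2 hpq.le)
      hf.abs.continuousOn
    refine ⟨x, hx, ?_⟩
    by_contra hne
    obtain ⟨k, hk⟩ := exists_nat_one_div_lt (abs_pos.2 hne)
    obtain ⟨r, hr, hfr⟩ := h k
    exact absurd (hmin hr) (not_le.2 (hfr.trans hk))

theorem measurableSet_exists_zero_Icc {α : Type*} [MeasurableSpace α] {F : α → ℝ → ℝ}
    (hF : ∀ x, Measurable fun a => F a x) (hc : ∀ a, Continuous (F a)) {p q : ℝ} (hpq : p < q) :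
    MeasurableSet {a | ∃ x ∈ Set.Icc p q, F a x = 0} := by
  have heq : {a | ∃ x ∈ Set.Icc p q, F a x = 0} =
      ⋂ k : ℕ, ⋃ r : ℚ, {a | (r : ℝ) ∈ Set.Icc p q ∧ |F a r| < 1 / ((k : ℝ) + 1)} := by
    ext a
    simp only [Set.mem_iInter, Set.mem_iUnion]
    exact exists_zero_Icc_iff (hc a) hpq
  rw [heq]
  exact MeasurableSet.iInter fun k => MeasurableSet.iUnion fun r =>
    (MeasurableSet.const _).inter (measurableSet_lt (hF r).abs measurable_const)

theorem encard_le_of_forall_finset_card_le {β : Type*} {S : Set β} {R : ℝ≥0∞}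
    (h : ∀ A : Finset β, (A : Set β) ⊆ S → (A.card : ℝ≥0∞) ≤ R) : (S.encard : ℝ≥0∞) ≤ R := by
  by_cases hS : S.Finite
  · have := h hS.toFinset (by simp)
    rwa [hS.encard_eq_coe_toFinset_card]
  · have hR : R = ∞ := ENNReal.eq_top_of_forall_nnreal_le fun r => by
      obtain ⟨N, hN⟩ := exists_nat_ge r
      obtain ⟨A, hA, hcard⟩ := Set.Infinite.exists_subset_card_eq hS N
      have := h A hA
      rw [hcard] at this
      exact le_trans (by exact_mod_cast hN) this
    rw [hR]; exact le_top

/-- A finite family of disjoint closed intervals with rational endpoints inside `(u, v)`. -/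
abbrev RatIntervals (u v : ℝ) : Type :=
  {T : Finset (ℚ × ℚ) // (T : Set (ℚ × ℚ)).PairwiseDisjoint
      (fun I => Set.Icc (I.1 : ℝ) (I.2 : ℝ)) ∧
    ∀ I ∈ T, (I.1 : ℝ) < I.2 ∧ Set.Icc (I.1 : ℝ) (I.2 : ℝ) ⊆ Set.Ioo u v}

theorem exists_ratIntervals {u v : ℝ} (A : Finset ℝ) (hA : (A : Set ℝ) ⊆ Set.Ioo u v) :
    ∃ T : RatIntervals u v, T.1.card = A.card ∧
      ∀ I ∈ T.1, ∃ z ∈ A, z ∈ Set.Icc (I.1 : ℝ) (I.2 : ℝ) := by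
  classical
  obtain ⟨U, hU, hdisj⟩ := A.finite_toSet.t2_separation
  have hex : ∀ z : ℝ, ∃ I : ℚ × ℚ, z ∈ A → (I.1 : ℝ) < z ∧ z < I.2 ∧
      Set.Icc (I.1 : ℝ) (I.2 : ℝ) ⊆ U z ∩ Set.Ioo u v := by
    intro z
    by_cases hz : z ∈ A
    · obtain ⟨l, r, hlr, hsub⟩ := mem_nhds_iff_exists_Ioo_subset.1
        (((hU z).2.inter isOpen_Ioo).mem_nhds ⟨(hU z).1, hA hz⟩)
      obtain ⟨p, hp1, hp2⟩ := exists_rat_btwn hlr.1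
      obtain ⟨q, hq1, hq2⟩ := exists_rat_btwn hlr.2
      exact ⟨(p, q), fun _ => ⟨hp2, hq1, (Set.Icc_subset_Ioo hp1 hq2).trans hsub⟩⟩
    · exact ⟨(0, 0), fun h => absurd h hz⟩
  choose J hJ using hex
  have hmem : ∀ z ∈ A, z ∈ Set.Icc ((J z).1 : ℝ) ((J z).2 : ℝ) := fun z hz =>
    ⟨(hJ z hz).1.le, (hJ z hz).2.1.le⟩
  have hinj : Set.InjOn J A := fun z hz w hw h => by
    by_contra hne
    have h1 : w ∈ U z := ((hJ z hz).2.2 (h ▸ hmem w hw)).1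
    exact Set.disjoint_left.1 (hdisj hz hw hne) h1 (hU w).1
  refine ⟨⟨A.image J, ?_, ?_⟩, Finset.card_image_of_injOn hinj, ?_⟩
  · intro I hI I' hI' hne
    obtain ⟨z, hz, rfl⟩ := Finset.mem_image.1 (Finset.mem_coe.1 hI)
    obtain ⟨w, hw, rfl⟩ := Finset.mem_image.1 (Finset.mem_coe.1 hI')
    have hzw : z ≠ w := fun h => hne (by rw [h])
    exact (hdisj hz hw hzw).mono (fun x hx => ((hJ z hz).2.2 hx).1)
      (fun x hx => ((hJ w hw).2.2 hx).1)
  · intro I hI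
    obtain ⟨z, hz, rfl⟩ := Finset.mem_image.1 hI
    exact ⟨(hJ z hz).1.trans (hJ z hz).2.1, fun x hx => ((hJ z hz).2.2 hx).2⟩
  · intro I hI
    obtain ⟨z, hz, rfl⟩ := Finset.mem_image.1 hI
    exact ⟨z, hz, hmem z hz⟩

-- Finitely many zeros can be separated by disjoint rational intervals, and disjoint intervals
-- meeting the zero set yield distinct zeros. The index set is countable, hence measurability.
open Classical in
theorem zeroCount_Ioo_eq_iSup (f : ℝ → ℝ) (u v : ℝ) :
    zeroCount f (Set.Ioo u v) = ⨆ T : RatIntervals u v, ∑ I ∈ T.1,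
      if ∃ x ∈ Set.Icc (I.1 : ℝ) (I.2 : ℝ), f x = 0 then (1 : ℝ≥0∞) else 0 := by
  refine le_antisymm (encard_le_of_forall_finset_card_le fun A hA => ?_) (iSup_le fun T => ?_)
  · obtain ⟨T, hcard, hT⟩ := exists_ratIntervals A (hA.trans Set.inter_subset_left)
    refine le_trans (le_of_eq ?_) (le_iSup _ T)
    rw [Finset.sum_congr rfl fun I hI => if_pos ?_]
    · simp [hcard]
    · obtain ⟨z, hz, hzI⟩ := hT I hI
      exact ⟨z, hzI, (hA hz).2⟩
  · rw [Finset.sum_boole]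
    have hex : ∀ I : ℚ × ℚ, ∃ x, (∃ x ∈ Set.Icc (I.1 : ℝ) (I.2 : ℝ), f x = 0) →
        x ∈ Set.Icc (I.1 : ℝ) (I.2 : ℝ) ∧ f x = 0 := fun I => by
      by_cases h : ∃ x ∈ Set.Icc (I.1 : ℝ) (I.2 : ℝ), f x = 0
      · obtain ⟨x, hx⟩ := h
        exact ⟨x, fun _ => hx⟩
      · exact ⟨0, fun h' => absurd h' h⟩
    choose g hg using hex
    set T' := T.1.filter fun I => ∃ x ∈ Set.Icc (I.1 : ℝ) (I.2 : ℝ), f x = 0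
    have hg' : ∀ I ∈ T', I ∈ T.1 ∧ g I ∈ Set.Icc (I.1 : ℝ) (I.2 : ℝ) ∧ f (g I) = 0 :=
      fun I hI => ⟨(Finset.mem_filter.1 hI).1, hg I (Finset.mem_filter.1 hI).2⟩
    have hinj : Set.InjOn g T' := fun I hI I' hI' h => by
      by_contra hne
      exact Set.disjoint_left.1 (T.2.1 (hg' I hI).1 (hg' I' hI').1 hne) (hg' I hI).2.1
        (h ▸ (hg' I' hI').2.1)
    have hsub : (T'.image g : Set ℝ) ⊆ Set.Ioo u v ∩ {x | f x = 0} := by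
      intro x hx
      obtain ⟨I, hI, rfl⟩ := Finset.mem_image.1 (Finset.mem_coe.1 hx)
      exact ⟨(T.2.2 I (hg' I hI).1).2 (hg' I hI).2.1, (hg' I hI).2.2⟩
    have := Set.encard_le_encard hsub
    rw [Set.encard_coe_eq_coe_finsetCard, Finset.card_image_of_injOn hinj] at this
    have h2 := ENat.toENNReal_mono this
    simpa [zeroCount] using h2

theorem measurable_zeroCount_Ioo {α : Type*} [MeasurableSpace α] {F : α → ℝ → ℝ}
    (hF : ∀ x, Measurable fun a => F a x) (hc : ∀ a, Continuous (F a)) (u v : ℝ) :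
    Measurable fun a => zeroCount (F a) (Set.Ioo u v) := by
  classical
  simp only [zeroCount_Ioo_eq_iSup]
  refine Measurable.iSup fun T => Finset.measurable_sum _ fun I hI => ?_
  exact Measurable.ite (measurableSet_exists_zero_Icc hF hc (T.2.2 I hI).1)
    measurable_const measurable_const

theorem aemeasurable_zeroCount_cosPoly {Ω : Type*} [MeasurableSpace Ω] {P : Measure Ω} (n : ℕ)
    {a : ℕ → Ω → ℝ} (ha : ∀ j ≤ n, AEMeasurable (a j) P) (u v : ℝ) :
    AEMeasurable (fun ω => zeroCount (cosPoly n (fun j => a j ω)) (Set.Ioo u v)) P := by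
  have hG : Measurable fun c : ℕ → ℝ => zeroCount (cosPoly n c) (Set.Ioo u v) :=
    measurable_zeroCount_Ioo (fun x => by unfold cosPoly; fun_prop)
      (fun c => by unfold cosPoly; fun_prop) u v
  -- Nothing is known about `a j` for `j > n`, so these are replaced by `0`.
  have hvec : AEMeasurable (fun ω (j : ℕ) => if j ≤ n then a j ω else 0) P :=
    aemeasurable_pi_lambda _ fun j => by
      by_cases hj : j ≤ n
      · simpa [hj] using ha j hj
      · simp [hj]
  refine (hG.comp_aemeasurable hvec).congr (Filter.Eventually.of_forall fun ω => ?_)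
  have : cosPoly n (fun j => if j ≤ n then a j ω else 0) = cosPoly n (fun j => a j ω) := by
    ext x
    exact Finset.sum_congr rfl fun j hj => by
      simp [Nat.lt_succ_iff.1 (Finset.mem_range.1 hj)]
  simp [Function.comp_apply, this]

/-! ### Almost sure bounds and the expectation -/

theorem IsPeriodicUpTo.apply_mod {α : Type*} {ℓ n : ℕ} {c : ℕ → α} (hc : IsPeriodicUpTo ℓ n c)
    {j : ℕ} (hj : j ≤ n) : c j = c (j % ℓ) := by
  have h := hc.apply_mul_add (j / ℓ) (j % ℓ) (by rwa [Nat.div_add_mod])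
  rwa [Nat.div_add_mod] at h

/-- Almost surely `2n - 2ℓ - 1 ≤ N_n ≤ 2n`. -/
theorem ae_zeroCount_cosPoly_bounds {ℓ k n : ℕ} (hℓ : 1 ≤ ℓ) (hn : n + 1 = ℓ * (k + 1))
    {Ω : Type*} [MeasurableSpace Ω] {P : Measure Ω} [IsProbabilityMeasure P] {v : ℝ≥0}
    (hv : 0 < v) {a : ℕ → Ω → ℝ} (hind : iIndepFun (fun i : Fin ℓ => a i) P)
    (hlaw : ∀ i : Fin ℓ, HasLaw (a i) (gaussianReal 0 v) P) (hper : IsPeriodicUpTo ℓ n a) :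
    ∀ᵐ ω ∂P,
      zeroCount (cosPoly n (fun j => a j ω)) (Set.Ioo 0 (2 * Real.pi)) ≤ (2 * n : ℕ) ∧
      ((2 * n : ℕ) : ℝ≥0∞) ≤
        zeroCount (cosPoly n (fun j => a j ω)) (Set.Ioo 0 (2 * Real.pi)) + (2 * ℓ + 1 : ℕ) := by
  have h0 : ∀ᵐ ω ∂P, a 0 ω ≠ 0 := by
    have := ae_sum_mul_ne_zero hv hind hlaw (fun i => if i = ⟨0, hℓ⟩ then 1 else 0)
      ⟨⟨0, hℓ⟩, by simp⟩
    simpa using this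
  -- For each fixed `x`, `W(x)` is a linear combination of the `a_j`, nontrivial unless `x = π`;
  -- finitely many null events are excluded.
  have hgen : ∀ᵐ ω ∂P, ∀ x ∈ circlePoints (n + 1) (Finset.Icc 1 n), x ≠ Real.pi →
      rePhase (ℓ * k) (periodPolynomial ℓ fun j => a j ω) x ≠ 0 := by
    rw [Filter.eventually_all_finset]
    intro x hx
    rw [Filter.eventually_imp_distrib_left]
    intro hxpi
    have hsin := sin_eq_zero_of_mem_circlePoints (Nat.le_add_left 1 n) hx
    rw [hn, Nat.mul_succ] at hsin
    obtain ⟨j, hj, hcos⟩ := exists_cos_ne_zero hℓ (circlePoints_subset_Ioo n hx) hxpi hsin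
    filter_upwards [ae_sum_mul_ne_zero hv hind hlaw
      (fun i : Fin ℓ => Real.cos ((i : ℕ) * x + (ℓ * k : ℕ) * (x / 2))) ⟨⟨j, hj⟩, hcos⟩] with ω hω
    rw [rePhase_periodPolynomial, Finset.sum_range]
    simpa only [mul_comm (Real.cos _)] using hω
  filter_upwards [h0, hgen] with ω hω0 hωgen
  obtain ⟨Z, hZ, hcard⟩ := exists_finset_zeros_cosPoly n (fun j => a j ω) hω0
  have hlow := two_mul_le_card_zeros_cosPoly ℓ k n hℓ hn (fun j => a j ω)
    (fun i hi => congrFun (hper i hi) ω) Z hZ hωgen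
  have hcount : zeroCount (cosPoly n (fun j => a j ω)) (Set.Ioo 0 (2 * Real.pi)) = Z.card := by
    rw [zeroCount, ← hZ, Set.encard_coe_eq_coe_finsetCard]
    simp
  rw [hcount]
  exact ⟨by exact_mod_cast hcard, by exact_mod_cast hlow⟩

theorem theorem2p2 (ℓ : ℕ) (hℓ : 1 ≤ ℓ) :
    ∃ C : ℝ, ∀ (m : ℕ), 1 ≤ m → ∀ (n : ℕ), n + 1 = ℓ * m →
      ∀ (Ω : Type*) [MeasurableSpace Ω] (P : Measure Ω) [IsProbabilityMeasure P]
        (σ : ℝ≥0) (_ : 0 < σ) (a : ℕ → Ω → ℝ),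
        iIndepFun (fun i : Fin ℓ => a i) P →
        (∀ i : Fin ℓ, HasLaw (a i) (gaussianReal 0 (σ ^ 2)) P) →
        IsPeriodicUpTo ℓ n a →
        AEMeasurable
            (fun ω => zeroCount (cosPoly n (fun j => a j ω)) (Set.Ioo 0 (2 * Real.pi))) P ∧
          ∫⁻ ω, zeroCount (cosPoly n (fun j => a j ω)) (Set.Ioo 0 (2 * Real.pi)) ∂P ≠ ∞ ∧
          |(∫⁻ ω, zeroCount (cosPoly n (fun j => a j ω)) (Set.Ioo 0 (2 * Real.pi)) ∂P).toReal
              - 2 * (n : ℝ)| ≤ C * (n : ℝ) ^ (2 / 3 : ℝ) := by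
  refine ⟨2 * ℓ + 1, fun m hm n hn Ω _ P _ σ hσ a hind hlaw hper => ?_⟩
  obtain ⟨k, rfl⟩ := Nat.exists_eq_add_of_le' hm
  set N : Ω → ℝ≥0∞ := fun ω => zeroCount (cosPoly n (fun j => a j ω)) (Set.Ioo 0 (2 * Real.pi))
  have hbounds := ae_zeroCount_cosPoly_bounds hℓ hn (pow_pos hσ 2) hind hlaw hper
  have hle : ∫⁻ ω, N ω ∂P ≤ (2 * n : ℕ) := by
    simpa using lintegral_mono_ae (hbounds.mono fun ω h => h.1)
  have hge : ((2 * n : ℕ) : ℝ≥0∞) ≤ ∫⁻ ω, N ω ∂P + (2 * ℓ + 1 : ℕ) := by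
    have := lintegral_mono_ae (hbounds.mono fun ω h => h.2)
    rw [lintegral_add_right _ measurable_const] at this
    simpa using this
  have hfin : ∫⁻ ω, N ω ∂P ≠ ∞ := ne_top_of_le_ne_top (ENNReal.natCast_ne_top _) hle
  refine ⟨aemeasurable_zeroCount_cosPoly n (fun j hj => ?_) _ _, hfin, ?_⟩
  · rw [hper.apply_mod hj]
    exact (hlaw ⟨j % ℓ, Nat.mod_lt _ hℓ⟩).aemeasurable
  · have hle' : (∫⁻ ω, N ω ∂P).toReal ≤ 2 * n := by
      have := ENNReal.toReal_mono (ENNReal.natCast_ne_top _) hle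
      rw [ENNReal.toReal_natCast] at this
      exact_mod_cast this
    have hge' : 2 * (n : ℝ) ≤ (∫⁻ ω, N ω ∂P).toReal + (2 * ℓ + 1) := by
      have := ENNReal.toReal_mono (ENNReal.add_ne_top.2 ⟨hfin, ENNReal.natCast_ne_top _⟩) hge
      rw [ENNReal.toReal_add hfin (ENNReal.natCast_ne_top _), ENNReal.toReal_natCast,
        ENNReal.toReal_natCast] at this
      exact_mod_cast this
    rw [abs_of_nonpos (by linarith)]
    -- At `n = 0` the right side is zero, but the upper bound `2n` already forces the expectation to
    -- be `0`.
    rcases Nat.eq_zero_or_pos n with rfl | hnpos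
    · have h0 : (0 : ℝ) ≤ (∫⁻ ω, N ω ∂P).toReal := ENNReal.toReal_nonneg
      have h1 : (0 : ℝ) ≤ (2 * ℓ + 1) * ((0 : ℕ) : ℝ) ^ (2 / 3 : ℝ) := by positivity
      push_cast at *
      linarith
    · have h1 : (1 : ℝ) ≤ (n : ℝ) ^ (2 / 3 : ℝ) :=
        Real.one_le_rpow (by exact_mod_cast hnpos) (by norm_num)
      have h2 : (2 * ℓ + 1 : ℝ) ≤ (2 * ℓ + 1) * (n : ℝ) ^ (2 / 3 : ℝ) :=
        le_mul_of_one_le_right (by positivity) h1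
      linarith
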